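/- Let $*$ be a continuous t-norm on $[0,1]$, that is, a continuous map $*\colon[0,1]\times[0,1]\to[0,1]$ that is monotone in each argument and makes $([0,1],*,1)$ a commutative monoid. Let $p\to r=\max\{q\in[0,1]\mid p*q\le r\}$ be its residuum. A $[0,1]_*$-set is a set $X$ with a map $\alpha\colon X\times X\to[0,1]$ such that for all $x,y,z\in X$: $\alpha(x,y)\le\alpha(x,x)\wedge\alpha(y,y)$; $\alpha(x,y)=\alpha(y,x)$; and $\alpha(y,z)*(\alpha(y,y)\to\alpha(x,y))\le\alpha(x,z)$. A morphism $(X,\alpha)\to(Y,\beta)$ of $[0,1]_*$-sets is a map $\phi\colon X\times Y\to[0,1]$ such that for all $x,x'\in X$ and $y,y'\in Y$: 1. $\phi(x,y)\le\alpha(x,x)\wedge\beta(y,y)$, 2. $(\beta(y,y)\to\beta(y,y'))*\phi(x,y)*(\alpha(x,x)\to\alpha(x',x))\le\phi(x',y')$, 3. $\phi(x,y')*(\alpha(x,x)\to\phi(x,y))\le\beta(y,y')$, 4. $\alpha(x,x')\le\bigvee_{y\in Y}\phi(x',y)*(\beta(y,y)\to\phi(x,y))$ (conditions 1 and 2 say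 that $\phi$ is a $\mathsf{D}[0,1]_*$-distributor, conditions 3 and 4 that it is left adjoint to its transpose). The composite of $\phi\colon(X,\alpha)\to(Y,\beta)$ and $\psi\colon(Y,\beta)\to(Z,\gamma)$ is $$(\psi\circ\phi)(x,z)=\bigvee_{y\in Y}\psi(y,z)*(\beta(y,y)\to\phi(x,y)),$$ and the identity morphism of $(X,\alpha)$ is $\alpha$. Let $[0,1]_*\text{-}\mathbf{Set}$ be the resulting category. Then $[0,1]_*\text{-}\mathbf{Set}$ is cartesian closed (it has finite products, and for every object $Y$ the functor $-\times Y$ has a right adjoint) if and only if $*$ is the minimum t-norm, $p*q=\min\{p,q\}$ for all $p,q\in[0,1]$. -/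

import Mathlib

open CategoryTheory
open scoped unitInterval

universe u v

/-- A continuous t-norm on the unit interval `I = [0,1]`. -/
@[ext]
structure ContinuousTNorm where
  op : I → I → I
  assoc : ∀ p q r, op (op p q) r = op p (op q r)
  comm : ∀ p q, op p q = op q p
  one_op : ∀ p, op 1 p = p
  mono : ∀ p p' q q', p ≤ p' → q ≤ q' → op p q ≤ op p' q'
  cont : Continuous fun x : I × I => op x.1 x.2

namespace ContinuousTNorm

variable (T : ContinuousTNorm)

/-- The residuum `p → r`, the largest `q` with `p * q ≤ r` (see `op_le_iff`). -/
noncomputable def imp (p r : I) : I := sSup {q | T.op p q ≤ r}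

/-- The minimum t-norm. -/
def minimum : ContinuousTNorm where
  op p q := p ⊓ q
  assoc := inf_assoc
  comm := inf_comm
  one_op p := inf_eq_right.2 p.2.2
  mono _ _ _ _ := inf_le_inf
  cont := by fun_prop

lemma op_one (p : I) : T.op p 1 = p := by rw [T.comm, T.one_op]

lemma op_zero (p : I) : T.op p 0 = 0 :=
  le_antisymm (by simpa [T.one_op] using T.mono p 1 0 0 p.2.2 le_rfl) (T.op p 0).2.1

lemma op_left (p : I) {q r : I} (h : q ≤ r) : T.op p q ≤ T.op p r := T.mono _ _ _ _ le_rfl h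

lemma op_right (p : I) {q r : I} (h : q ≤ r) : T.op q p ≤ T.op r p := T.mono _ _ _ _ h le_rfl

lemma op_le_left (p q : I) : T.op p q ≤ p := by
  simpa [T.op_one] using T.op_left p (show q ≤ 1 from q.2.2)

lemma op_le_right (p q : I) : T.op p q ≤ q := by rw [T.comm]; exact T.op_le_left q p

lemma op_left_comm (p q r : I) : T.op p (T.op q r) = T.op q (T.op p r) := by
  rw [← T.assoc, T.comm p q, T.assoc]

lemma cont_left (p : I) : Continuous (T.op p) :=
  T.cont.comp (continuous_const.prodMk continuous_id)

lemma op_le_iff (p q r : I) : T.op p q ≤ r ↔ q ≤ T.imp p r := by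
  constructor
  · intro h
    exact le_sSup h
  · intro h
    have hc : IsClosed {q | T.op p q ≤ r} := isClosed_le (T.cont_left p) continuous_const
    have hm : T.imp p r ∈ {q | T.op p q ≤ r} :=
      hc.sSup_mem ⟨0, (T.op_zero p).trans_le r.2.1⟩
    exact (T.op_left p h).trans hm

lemma op_imp_le (p r : I) : T.op p (T.imp p r) ≤ r := (T.op_le_iff _ _ _).2 le_rfl

lemma op_imp {q w : I} (h : w ≤ q) : T.op q (T.imp q w) = w := by
  refine le_antisymm (T.op_imp_le q w) ?_
  have hmem : w ∈ Set.Icc (T.op q 0) (T.op q 1) := by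
    rw [T.op_zero, T.op_one]
    exact ⟨w.2.1, h⟩
  obtain ⟨t, ht⟩ := intermediate_value_univ 0 1 (T.cont_left q) hmem
  rw [← ht]
  exact T.op_left q ((T.op_le_iff _ _ _).1 le_rfl)

lemma imp_self (p : I) : T.imp p p = 1 :=
  le_antisymm (T.imp p p).2.2 ((T.op_le_iff _ _ _).1 (by rw [T.op_one]))

lemma imp_mono (p : I) {q r : I} (h : q ≤ r) : T.imp p q ≤ T.imp p r :=
  (T.op_le_iff _ _ _).1 ((T.op_imp_le p q).trans h)

lemma imp_op_le (p q r : I) : T.op (T.imp p q) r ≤ T.imp p (T.op q r) := by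
  rw [← T.op_le_iff, ← T.assoc]
  exact T.op_right r (T.op_imp_le p q)

lemma swap {q a b : I} (ha : a ≤ q) (hb : b ≤ q) :
    T.op b (T.imp q a) = T.op (T.imp q b) a := by
  conv_lhs => rw [← T.op_imp hb]
  conv_rhs => rw [← T.op_imp ha]
  rw [T.assoc, T.op_left_comm]

lemma op_iSup {ι : Sort v} (p : I) (f : ι → I) : T.op p (⨆ i, f i) = ⨆ i, T.op p (f i) :=
  (show GaloisConnection (T.op p) (T.imp p) from T.op_le_iff p).l_iSup

lemma iSup_op {ι : Sort v} (p : I) (f : ι → I) : T.op (⨆ i, f i) p = ⨆ i, T.op (f i) p := by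
  simp only [T.comm _ p, op_iSup]

end ContinuousTNorm

/-- A `[0,1]_*`-valued set: a set with a `[0,1]_*`-valued equality `eq`. -/
structure ValuedSet (T : ContinuousTNorm) where
  carrier : Type u
  eq : carrier → carrier → I
  le_extent : ∀ x y, eq x y ≤ eq x x ⊓ eq y y
  symm : ∀ x y, eq x y = eq y x
  trans : ∀ x y z, T.op (eq y z) (T.imp (eq y y) (eq x y)) ≤ eq x z

namespace ValuedSet

variable {T : ContinuousTNorm}

/-- A morphism of `[0,1]_*`-sets. The fields `le_extent` and `compat` say that `rel` is a
`D[0,1]_*`-distributor; `functional` and `total` are the counit and the unit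
of the adjunction between `rel` and its transpose. -/
@[ext]
structure Hom (X Y : ValuedSet.{u} T) where
  rel : X.carrier → Y.carrier → I
  le_extent : ∀ x y, rel x y ≤ X.eq x x ⊓ Y.eq y y
  compat : ∀ x x' y y', T.op (T.op (T.imp (Y.eq y y) (Y.eq y y')) (rel x y))
    (T.imp (X.eq x x) (X.eq x' x)) ≤ rel x' y'
  functional : ∀ x y y', T.op (rel x y') (T.imp (X.eq x x) (rel x y)) ≤ Y.eq y y'
  total : ∀ x x', X.eq x x' ≤ ⨆ y, T.op (rel x' y) (T.imp (Y.eq y y) (rel x y))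

lemma eq_le_left (X : ValuedSet.{u} T) (x y : X.carrier) : X.eq x y ≤ X.eq x x :=
  (X.le_extent x y).trans inf_le_left

lemma eq_le_right (X : ValuedSet.{u} T) (x y : X.carrier) : X.eq x y ≤ X.eq y y :=
  (X.le_extent x y).trans inf_le_right

namespace Hom

lemma le_left {X Y : ValuedSet.{u} T} (f : Hom X Y) (x : X.carrier) (y : Y.carrier) :
    f.rel x y ≤ X.eq x x := (f.le_extent x y).trans inf_le_left

lemma le_right {X Y : ValuedSet.{u} T} (f : Hom X Y) (x : X.carrier) (y : Y.carrier) :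
    f.rel x y ≤ Y.eq y y := (f.le_extent x y).trans inf_le_right

lemma compat_left {X Y : ValuedSet.{u} T} (f : Hom X Y) (x x' : X.carrier) (y : Y.carrier) :
    T.op (f.rel x y) (T.imp (X.eq x x) (X.eq x' x)) ≤ f.rel x' y := by
  simpa [T.imp_self, T.one_op] using f.compat x x' y y

lemma compat_right {X Y : ValuedSet.{u} T} (f : Hom X Y) (x : X.carrier) (y y' : Y.carrier) :
    T.op (T.imp (Y.eq y y) (Y.eq y y')) (f.rel x y) ≤ f.rel x y' := by
  simpa [T.imp_self, T.op_one] using f.compat x x y y'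

/-- The identity morphism is the equality itself. -/
def id (X : ValuedSet.{u} T) : Hom X X where
  rel := X.eq
  le_extent := X.le_extent
  compat x x' y y' := by
    rw [T.assoc]
    refine (T.op_left _ (X.trans x' x y)).trans ?_
    rw [← T.swap (X.eq_le_right x' y) (X.eq_le_left y y')]
    exact X.trans x' y y'
  functional x y y' := by
    rw [X.symm x y]
    exact X.trans y x y'
  total x x' := by
    refine le_trans ?_ (le_iSup _ x')
    rw [T.op_imp (X.eq_le_right x x')]

/-- The composite `ψ ∘ φ` of `φ : X ⇸ Y` and `ψ : Y ⇸ Z`, as a relation. -/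
noncomputable def compRel {X Y Z : ValuedSet.{u} T} (φ : Hom X Y) (ψ : Hom Y Z)
    (x : X.carrier) (z : Z.carrier) : I :=
  ⨆ y, T.op (ψ.rel y z) (T.imp (Y.eq y y) (φ.rel x y))

lemma compRel_eq {X Y Z : ValuedSet.{u} T} (φ : Hom X Y) (ψ : Hom Y Z)
    (x : X.carrier) (z : Z.carrier) :
    compRel φ ψ x z = ⨆ y, T.op (T.imp (Y.eq y y) (ψ.rel y z)) (φ.rel x y) := by
  unfold compRel
  congr 1
  funext y
  exact T.swap (φ.le_right x y) (ψ.le_left y z)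

lemma compRel_le_left {X Y Z : ValuedSet.{u} T} (φ : Hom X Y) (ψ : Hom Y Z)
    (x : X.carrier) (z : Z.carrier) : compRel φ ψ x z ≤ X.eq x x := by
  rw [compRel_eq]
  exact iSup_le fun y => (T.op_le_right _ _).trans (φ.le_left x y)

lemma compRel_le_right {X Y Z : ValuedSet.{u} T} (φ : Hom X Y) (ψ : Hom Y Z)
    (x : X.carrier) (z : Z.carrier) : compRel φ ψ x z ≤ Z.eq z z :=
  iSup_le fun y => (T.op_le_left _ _).trans (ψ.le_right y z)

lemma compRel_functional {X Y Z : ValuedSet.{u} T} (φ : Hom X Y) (ψ : Hom Y Z)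
    (x : X.carrier) (z z' : Z.carrier) :
    T.op (compRel φ ψ x z') (T.imp (X.eq x x) (compRel φ ψ x z)) ≤ Z.eq z z' := by
  rw [T.swap (compRel_le_left φ ψ x z) (compRel_le_left φ ψ x z'), compRel_eq φ ψ x z, T.op_iSup]
  refine iSup_le fun y => ?_
  rw [T.op_left_comm, ← T.swap (φ.le_left x y) (compRel_le_left φ ψ x z'), compRel_eq φ ψ x z',
    T.iSup_op, T.op_iSup]
  refine iSup_le fun y' => ?_
  rw [T.assoc]
  refine (T.op_left _ (T.op_left _ (φ.functional x y y'))).trans ?_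
  rw [← T.swap (Y.eq_le_right y y') (ψ.le_left y' z')]
  refine (T.op_left _ (ψ.compat_left y' y z')).trans ?_
  rw [T.comm]
  exact ψ.functional y z z'

lemma compRel_total {X Y Z : ValuedSet.{u} T} (φ : Hom X Y) (ψ : Hom Y Z) (x x' : X.carrier) :
    X.eq x x' ≤ ⨆ z, T.op (compRel φ ψ x' z) (T.imp (Z.eq z z) (compRel φ ψ x z)) := by
  refine (φ.total x x').trans (iSup_le fun y => ?_)
  have h1 : T.op (φ.rel x' y) (T.imp (Y.eq y y) (φ.rel x y)) =
      T.op (T.op (T.imp (Y.eq y y) (φ.rel x' y)) (T.imp (Y.eq y y) (φ.rel x y))) (Y.eq y y) := by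
    conv_lhs => rw [← T.op_imp (φ.le_right x' y)]
    rw [T.assoc, T.comm]
  rw [h1]
  refine (T.op_left _ (ψ.total y y)).trans ?_
  rw [T.op_iSup]
  refine iSup_mono fun z => ?_
  have h2 : T.op (T.op (T.imp (Y.eq y y) (φ.rel x' y)) (T.imp (Y.eq y y) (φ.rel x y)))
      (T.op (ψ.rel y z) (T.imp (Z.eq z z) (ψ.rel y z))) =
      T.op (T.op (ψ.rel y z) (T.imp (Y.eq y y) (φ.rel x' y)))
        (T.op (T.imp (Z.eq z z) (ψ.rel y z)) (T.imp (Y.eq y y) (φ.rel x y))) := by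
    simp only [T.assoc, T.comm, T.op_left_comm]
  rw [h2]
  refine T.mono _ _ _ _ (le_iSup (fun y => T.op (ψ.rel y z) (T.imp (Y.eq y y) (φ.rel x' y))) y) ?_
  refine (T.imp_op_le _ _ _).trans (T.imp_mono _ ?_)
  exact le_iSup (fun y => T.op (ψ.rel y z) (T.imp (Y.eq y y) (φ.rel x y))) y

/-- Composition of morphisms, in diagrammatic order. -/
noncomputable def comp {X Y Z : ValuedSet.{u} T} (φ : Hom X Y) (ψ : Hom Y Z) : Hom X Z where
  rel := compRel φ ψ
  le_extent x z := le_inf (compRel_le_left φ ψ x z) (compRel_le_right φ ψ x z)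
  compat x x' z z' := by
    rw [compRel, T.op_iSup, T.iSup_op]
    refine iSup_mono fun y => ?_
    rw [← T.assoc, T.assoc]
    refine T.mono _ _ _ _ (ψ.compat_right y z z') ?_
    exact (T.imp_op_le _ _ _).trans (T.imp_mono _ (φ.compat_left x x' y))
  functional := compRel_functional φ ψ
  total := compRel_total φ ψ

lemma id_comp {X Y : ValuedSet.{u} T} (φ : Hom X Y) : comp (id X) φ = φ := by
  ext x y : 3
  refine le_antisymm (iSup_le fun x' => φ.compat_left x' x y) ?_
  refine le_trans ?_ (le_iSup _ x)
  simp only [id, T.imp_self, T.op_one]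
  exact le_rfl

lemma comp_id {X Y : ValuedSet.{u} T} (φ : Hom X Y) : comp φ (id Y) = φ := by
  ext x y : 3
  change compRel φ (id Y) x y = _
  rw [compRel_eq]
  refine le_antisymm (iSup_le fun y' => φ.compat_right x y' y) ?_
  refine le_trans ?_ (le_iSup _ y)
  simp only [id, T.imp_self, T.one_op]
  exact le_rfl

lemma comp_assoc {W X Y Z : ValuedSet.{u} T} (φ : Hom W X) (ψ : Hom X Y) (χ : Hom Y Z) :
    comp (comp φ ψ) χ = comp φ (comp ψ χ) := by
  ext w z : 3
  change compRel (comp φ ψ) χ w z = compRel φ (comp ψ χ) w z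
  rw [compRel_eq]
  simp only [compRel, comp, T.op_iSup, T.iSup_op]
  rw [iSup_comm]
  congr 1
  funext x
  congr 1
  funext y
  rw [← T.assoc, ← T.swap (ψ.le_right x y) (χ.le_left y z)]

end Hom

/-- The category `[0,1]_*-Set`. -/
noncomputable instance : LargeCategory (ValuedSet.{u} T) where
  Hom := Hom
  id := Hom.id
  comp := Hom.comp
  id_comp := Hom.id_comp
  comp_id := Hom.comp_id
  assoc := Hom.comp_assoc

end ValuedSet

/-- A category is cartesian closed if it has finite products and each functor `Y × -` has a
right adjoint. -/
def IsCartesianClosed (C : Type u) [Category.{v} C] : Prop :=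
  ∃ _ : CartesianMonoidalCategory C, Nonempty (MonoidalClosed C)

/-! Equality of global elements is transitive for `*`, whereas equality on a product of global sets
is a minimum; an exponential can reconcile the two only if `*` is the minimum. Indeed, global
elements of the exponential of `W` by `Y` are families `Y → W`, so two families joined to degrees
`s` and `t` through a third are joined to degree `s * t` by a morphism on a product (`exists_glue`).
Let `c = p * p` and let `Y` have two points equal to degree `c`. Gluing two steps of degree `p`
gives a map to the truth values that falls from `1` to `p * c` between points equal to degree `min c
c = c`, so `p * p ≤ p * p * p` (`square_le_cube`). If this holds for all `p`, every square is
idempotent; by continuity every element is a square.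

For the minimum, `[0,1]` is a complete Heyting algebra with `*` as meet. The exponential consists of
partial morphisms with an extent, equal to the largest degree on which they agree (`curryMinEquiv`).

In both directions the order on morphisms is discrete (`Hom.eq_of_rel_le`), so equations between
morphisms need only one inequality. -/

namespace ContinuousTNorm

/-! ### Squares, cubes and idempotents of a continuous t-norm -/

variable (T : ContinuousTNorm)

lemma one_imp (r : I) : T.imp 1 r = r := by
  refine le_antisymm ?_ ((T.op_le_iff _ _ _).1 (T.one_op r).le)
  simpa [T.one_op] using T.op_imp_le 1 r

lemma eq_minimum_of_idempotent (h : ∀ p, T.op p p = p) : T = minimum := by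
  have key : ∀ p q, p ≤ q → T.op p q = p := fun p q hpq =>
    le_antisymm (T.op_le_left p q) ((h p).symm.le.trans (T.op_left p hpq))
  ext p q : 3
  change T.op p q = p ⊓ q
  rcases le_total p q with hpq | hpq
  · rw [key p q hpq, inf_eq_left.2 hpq]
  · rw [T.comm, key q p hpq, inf_eq_right.2 hpq]

/-- Otherwise multiplying a square by `p` never lowers it, so squares are idempotent; by the
intermediate value theorem every element is a square. -/
lemma exists_cube_lt_square (h : T ≠ minimum) : ∃ p, T.op p (T.op p p) < T.op p p := by
  by_contra! H
  refine h (T.eq_minimum_of_idempotent fun r => ?_)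
  have hc : Continuous fun p => T.op p p := T.cont.comp (continuous_id.prodMk continuous_id)
  have hmem : r ∈ Set.Icc (T.op 0 0) (T.op 1 1) := by
    rw [T.op_zero, T.op_one]
    exact r.2
  obtain ⟨p, rfl⟩ := intermediate_value_univ 0 1 hc hmem
  have h3 : T.op p (T.op p p) = T.op p p := le_antisymm (T.op_le_right _ _) (H p)
  change T.op (T.op p p) (T.op p p) = T.op p p
  rw [T.assoc, h3, h3]

lemma imp_op_imp_le (p q r : I) : T.op (T.imp p q) (T.imp q r) ≤ T.imp p r := by
  rw [← T.op_le_iff, ← T.assoc]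
  exact (T.op_right _ (T.op_imp_le p q)).trans (T.op_imp_le q r)

end ContinuousTNorm

/-! ### Comparing and constructing morphisms -/

namespace ValuedSet

variable {T : ContinuousTNorm}

namespace Hom

variable {X Y Z : ValuedSet.{u} T}

/-- The order on morphisms is discrete. -/
lemma eq_of_rel_le {f g : Hom X Y} (h : ∀ x y, f.rel x y ≤ g.rel x y) : f = g := by
  ext x y : 3
  refine le_antisymm (h x y) ?_
  -- Written as a multiple of `X.eq x x`, the value `g.rel x y` spreads over all `y'` by totality of
  -- `f`. As `f ≤ g`, functionality of `g` yields a factor `Y.eq y y'`, along which `f.rel x y'` is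
  -- transported to `y`.
  rw [← T.op_imp (g.le_left x y), T.comm]
  refine (T.op_left _ (f.total x x)).trans ?_
  rw [T.op_iSup]
  refine iSup_le fun y' => ?_
  rw [← T.assoc, T.comm (T.imp _ _) (f.rel x y')]
  refine (T.op_right _ ((T.op_right _ (h x y')).trans (g.functional x y y'))).trans ?_
  rw [T.swap (f.le_right x y') (Y.eq_le_right y y'), Y.symm y y']
  exact f.compat_right x y' y

/-- Totality may be checked on the diagonal. -/
def mkOfTotal (rel : X.carrier → Y.carrier → I)
    (le_extent : ∀ x y, rel x y ≤ X.eq x x ⊓ Y.eq y y)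
    (compat : ∀ x x' y y', T.op (T.op (T.imp (Y.eq y y) (Y.eq y y')) (rel x y))
      (T.imp (X.eq x x) (X.eq x' x)) ≤ rel x' y')
    (functional : ∀ x y y', T.op (rel x y') (T.imp (X.eq x x) (rel x y)) ≤ Y.eq y y')
    (total : ∀ x, X.eq x x ≤ ⨆ y, T.op (rel x y) (T.imp (Y.eq y y) (rel x y))) : Hom X Y where
  rel := rel
  le_extent := le_extent
  compat := compat
  functional := functional
  total x x' := by
    rw [← T.op_imp (X.eq_le_left x x')]
    refine (T.op_right _ (total x)).trans ?_
    rw [T.iSup_op]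
    refine iSup_mono fun y => ?_
    rw [T.assoc, T.comm (T.imp _ _), ← T.assoc, X.symm x x']
    refine T.op_right _ ?_
    simpa [T.imp_self, T.one_op] using compat x x' y y

/-- The morphism induced by a map of the carriers that preserves extents and does not decrease
equality. -/
def ofFun (m : X.carrier → Y.carrier) (hE : ∀ x, Y.eq (m x) (m x) = X.eq x x)
    (hm : ∀ x x', X.eq x x' ≤ Y.eq (m x) (m x')) : Hom X Y where
  rel x y := Y.eq (m x) y
  le_extent x y := by
    rw [← hE]
    exact Y.le_extent _ _
  compat x x' y y' := by
    rw [← hE]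
    exact (T.op_left _ (T.imp_mono _ (hm x' x))).trans ((id Y).compat (m x) (m x') y y')
  functional x y y' := by
    rw [← hE]
    exact (id Y).functional (m x) y y'
  total x x' := (hm x x').trans ((id Y).total (m x) (m x'))

/-- The supremum defining the left side is the one defining `id Y` followed by `g`, taken at `m x`.
-/
lemma comp_ofFun_rel (m : X.carrier → Y.carrier) (hE hm) (g : Hom Y Z) (x : X.carrier)
    (z : Z.carrier) : (comp (ofFun m hE hm) g).rel x z = g.rel (m x) z :=
  congrFun (congrFun (congrArg rel (id_comp g)) (m x)) z

/-- Makes a morphism nonexpansive wherever its values are represented by elements, even if no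
underlying map is known. -/
lemma eq_le_of_rel_eq (f : Hom X Y) {x x' : X.carrier} {y y' : Y.carrier}
    (h : f.rel x = Y.eq y) (h' : f.rel x' = Y.eq y') : X.eq x x' ≤ Y.eq y y' := by
  refine (f.total x x').trans (iSup_le fun w => ?_)
  rw [h, h', Y.symm y' w]
  exact Y.trans y w y'

end Hom

end ValuedSet

/-! ### Global valued sets and their products -/

namespace ValuedSet

variable {T : ContinuousTNorm}

/-- All elements have extent `1`. -/
class IsGlobal (X : ValuedSet.{u} T) : Prop where
  eq_self : ∀ x, X.eq x x = 1

/-- A `T`-similarity, as a valued set all of whose elements are global. -/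
def ofSimilarity (S : Type u) (d : S → S → I) (refl : ∀ x, d x x = 1)
    (symm : ∀ x y, d x y = d y x) (trans : ∀ x y z, T.op (d x y) (d y z) ≤ d x z) :
    ValuedSet.{u} T where
  carrier := S
  eq := d
  le_extent x y := by
    rw [refl, refl, inf_idem]
    exact (d x y).2.2
  symm := symm
  trans x y z := by
    rw [refl, T.one_imp, T.comm]
    exact trans x y z

instance (S : Type u) (d : S → S → I) (refl symm trans) :
    IsGlobal (ofSimilarity (T := T) S d refl symm trans) := ⟨refl⟩

lemma IsGlobal.trans {X : ValuedSet.{u} T} [IsGlobal X] (x y z : X.carrier) :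
    T.op (X.eq x y) (X.eq y z) ≤ X.eq x z := by
  simpa [IsGlobal.eq_self, T.one_imp, T.comm] using X.trans x y z

/-- The morphism induced by a map that does not decrease equality. -/
def ofMap {X Y : ValuedSet.{u} T} [IsGlobal X] [IsGlobal Y] (m : X.carrier → Y.carrier)
    (hm : ∀ x x', X.eq x x' ≤ Y.eq (m x) (m x')) : X ⟶ Y :=
  Hom.ofFun m (fun x => (IsGlobal.eq_self (m x)).trans (IsGlobal.eq_self x).symm) hm

lemma ofMap_comp_rel {X Y Z : ValuedSet.{u} T} [IsGlobal X] [IsGlobal Y]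
    (m : X.carrier → Y.carrier) (hm) (g : Y ⟶ Z) (x : X.carrier) (z : Z.carrier) :
    Hom.rel (ofMap m hm ≫ g) x z = Hom.rel g (m x) z :=
  Hom.comp_ofFun_rel m _ hm g x z

/-- The product of two valued sets all of whose elements are global. -/
def globalProd (X Y : ValuedSet.{u} T) [IsGlobal X] [IsGlobal Y] : ValuedSet.{u} T :=
  ofSimilarity (X.carrier × Y.carrier) (fun a b => X.eq a.1 b.1 ⊓ Y.eq a.2 b.2)
    (fun a => by simp [IsGlobal.eq_self])
    (fun a b => by rw [X.symm, Y.symm])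
    (fun a b c => le_inf
      ((T.mono _ _ _ _ inf_le_left inf_le_left).trans (IsGlobal.trans _ _ _))
      ((T.mono _ _ _ _ inf_le_right inf_le_right).trans (IsGlobal.trans _ _ _)))

section globalProd

variable (X Y : ValuedSet.{u} T) [IsGlobal X] [IsGlobal Y]

instance : IsGlobal (globalProd X Y) := inferInstanceAs (IsGlobal (ofSimilarity _ _ _ _ _))

/-- The first projection. -/
def globalFst : globalProd X Y ⟶ X :=
  ofMap Prod.fst (fun _ _ => inf_le_left)

/-- The second projection. -/
def globalSnd : globalProd X Y ⟶ Y :=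
  ofMap Prod.snd (fun _ _ => inf_le_right)

variable {X Y} {Z : ValuedSet.{u} T}

/-- The pairing of two morphisms. -/
def globalLift (f : Z ⟶ X) (g : Z ⟶ Y) : Z ⟶ globalProd X Y :=
  Hom.mkOfTotal (fun z a => Hom.rel f z a.1 ⊓ Hom.rel g z a.2)
    (fun z a => by
      rw [IsGlobal.eq_self a]
      exact le_inf (inf_le_left.trans (Hom.le_left f z a.1)) unitInterval.le_one')
    (fun z z' a b => by
      have hf := Hom.compat f z z' a.1 b.1
      have hg := Hom.compat g z z' a.2 b.2
      simp only [IsGlobal.eq_self, T.one_imp] at hf hg ⊢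
      exact le_inf
        ((T.op_right _ (T.mono _ _ _ _ inf_le_left inf_le_left)).trans hf)
        ((T.op_right _ (T.mono _ _ _ _ inf_le_right inf_le_right)).trans hg))
    (fun z a b => le_inf
      ((T.mono _ _ _ _ inf_le_left (T.imp_mono _ inf_le_left)).trans
        (Hom.functional f z a.1 b.1))
      ((T.mono _ _ _ _ inf_le_right (T.imp_mono _ inf_le_right)).trans
        (Hom.functional g z a.2 b.2)))
    (fun z => by
      have hf := Hom.total f z z
      have hg := Hom.total g z z
      simp only [IsGlobal.eq_self, T.one_imp] at hf hg ⊢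
      refine le_of_forall_lt fun t ht => ?_
      obtain ⟨x, hx⟩ := lt_iSup_iff.1 (ht.trans_le hf)
      obtain ⟨y, hy⟩ := lt_iSup_iff.1 (ht.trans_le hg)
      refine lt_iSup_iff.2 ⟨(x, y), ?_⟩
      -- By linearity the meet is one of the two values, and the square of each already exceeds `t`.
      rcases le_total (Hom.rel f z x) (Hom.rel g z y) with h | h
      · simpa only [inf_eq_left.2 h] using hx
      · simpa only [inf_eq_right.2 h] using hy)

lemma globalLift_fst (f : Z ⟶ X) (g : Z ⟶ Y) : globalLift f g ≫ globalFst X Y = f := by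
  refine Hom.eq_of_rel_le fun z x => iSup_le fun a => ?_
  refine (T.op_left _ (T.imp_mono _ inf_le_left)).trans ?_
  rw [IsGlobal.eq_self, ← IsGlobal.eq_self a.1]
  refine (Hom.compat_right f z a.1 x).trans' ?_
  exact (T.swap (Hom.le_right f z a.1) (X.eq_le_left a.1 x)).le

lemma globalLift_snd (f : Z ⟶ X) (g : Z ⟶ Y) : globalLift f g ≫ globalSnd X Y = g := by
  refine Hom.eq_of_rel_le fun z x => iSup_le fun a => ?_
  refine (T.op_left _ (T.imp_mono _ inf_le_right)).trans ?_
  rw [IsGlobal.eq_self, ← IsGlobal.eq_self a.2]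
  refine (Hom.compat_right g z a.2 x).trans' ?_
  exact (T.swap (Hom.le_right g z a.2) (Y.eq_le_left a.2 x)).le

lemma rel_le_comp_globalFst (h : Z ⟶ globalProd X Y) (z : Z.carrier)
    (a : (globalProd X Y).carrier) :
    Hom.rel h z a ≤ Hom.rel (h ≫ globalFst X Y) z a.1 := by
  refine le_trans ?_ (le_iSup _ a)
  change _ ≤ T.op (X.eq a.1 a.1) (T.imp ((globalProd X Y).eq a a) (Hom.rel h z a))
  rw [IsGlobal.eq_self, IsGlobal.eq_self, T.one_op, T.one_imp]

lemma rel_le_comp_globalSnd (h : Z ⟶ globalProd X Y) (z : Z.carrier)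
    (a : (globalProd X Y).carrier) :
    Hom.rel h z a ≤ Hom.rel (h ≫ globalSnd X Y) z a.2 := by
  refine le_trans ?_ (le_iSup _ a)
  change _ ≤ T.op (Y.eq a.2 a.2) (T.imp ((globalProd X Y).eq a a) (Hom.rel h z a))
  rw [IsGlobal.eq_self, IsGlobal.eq_self, T.one_op, T.one_imp]

lemma eq_globalLift (h : Z ⟶ globalProd X Y) :
    h = globalLift (h ≫ globalFst X Y) (h ≫ globalSnd X Y) :=
  Hom.eq_of_rel_le fun z a => le_inf (rel_le_comp_globalFst h z a) (rel_le_comp_globalSnd h z a)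

lemma globalProd_hom_ext {h k : Z ⟶ globalProd X Y}
    (h₁ : h ≫ globalFst X Y = k ≫ globalFst X Y) (h₂ : h ≫ globalSnd X Y = k ≫ globalSnd X Y) :
    h = k := by
  rw [eq_globalLift h, eq_globalLift k, h₁, h₂]

end globalProd

/-! ### Degrees of equality between global elements -/

section distance

/-- The singleton of extent `1`. -/
def point (T : ContinuousTNorm) : ValuedSet.{u} T :=
  ofSimilarity PUnit (fun _ _ => 1) (fun _ => rfl) (fun _ _ => rfl) (fun _ _ _ => (T.one_op 1).le)

instance : IsGlobal (point.{u} T) := inferInstanceAs (IsGlobal (ofSimilarity _ _ _ _ _))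

/-- The element of `point T`. -/
def star : (point.{u} T).carrier := PUnit.unit

/-- Two global elements that are equal to degree `s`. -/
def pair (T : ContinuousTNorm) (s : I) : ValuedSet.{u} T :=
  ofSimilarity (ULift Bool) (fun a b => if a = b then 1 else s) (fun _ => if_pos rfl)
    (fun a b => by simp only [eq_comm])
    (fun a b c => by
      by_cases hab : a = b
      · subst hab
        simp [T.one_op]
      · by_cases hbc : b = c
        · subst hbc
          simp [T.op_one]
        · simp only [if_neg hab, if_neg hbc]
          split_ifs
          · exact unitInterval.le_one'
          · exact T.op_le_left _ _)

instance (s : I) : IsGlobal (pair.{u} T s) := inferInstanceAs (IsGlobal (ofSimilarity _ _ _ _ _))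

/-- The elements of `pair T s`. -/
def pairElt (s : I) (b : Bool) : (pair.{u} T s).carrier := ⟨b⟩

lemma pair_eq_false_true (s : I) :
    (pair.{u} T s).eq (pairElt s false) (pairElt s true) = s := by
  simp [pair, ofSimilarity, pairElt]

/-- The inclusion of one of the two elements of `pair T s`. -/
def pairIncl (s : I) (b : Bool) : point.{u} T ⟶ pair T s :=
  ofMap (fun _ => pairElt s b)
    (fun _ _ => (IsGlobal.eq_self (pairElt s b)).symm ▸ unitInterval.le_one')

variable {E : ValuedSet.{u} T}

/-- The degree to which two global elements of `E` are equal. -/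
noncomputable def globalEq (e e' : point.{u} T ⟶ E) : I :=
  ⨆ w, T.op (Hom.rel e' star w) (T.imp (E.eq w w) (Hom.rel e star w))

lemma le_globalEq {s : I} (f : pair T s ⟶ E) :
    s ≤ globalEq (pairIncl s false ≫ f) (pairIncl s true ≫ f) := by
  have h := Hom.total f (pairElt s false) (pairElt s true)
  have hr (b : Bool) (w) : Hom.rel (pairIncl s b ≫ f) star w = Hom.rel f (pairElt s b) w :=
    ofMap_comp_rel _ _ f _ _
  simp only [globalEq, hr]
  rwa [pair_eq_false_true] at h

lemma globalEq_comm (e e' : point.{u} T ⟶ E) : globalEq e e' = globalEq e' e := by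
  unfold globalEq
  congr 1
  funext w
  rw [T.swap (Hom.le_right e _ w) (Hom.le_right e' _ w), T.comm]

/-- Functionality of `e` turns the two values of `e` into an equality in `E`, along which `e'` is
transported. -/
lemma globalEq_op_rel_le (e e' : point.{u} T ⟶ E) (w : E.carrier) :
    T.op (globalEq e e') (Hom.rel e star w) ≤ Hom.rel e' star w := by
  rw [globalEq, T.iSup_op]
  refine iSup_le fun v => ?_
  have h := Hom.functional e star w v
  rw [IsGlobal.eq_self, T.one_imp] at h
  rw [T.swap (Hom.le_right e _ v) (Hom.le_right e' _ v), T.assoc]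
  refine (T.op_left _ h).trans ?_
  rw [E.symm w v, ← T.swap (E.eq_le_left v w) (Hom.le_right e' _ v), T.comm]
  exact Hom.compat_right e' _ v w

lemma globalEq_trans (e e' e'' : point.{u} T ⟶ E) :
    T.op (globalEq e e') (globalEq e' e'') ≤ globalEq e e'' := by
  rw [globalEq_comm e e', globalEq, globalEq, T.op_iSup]
  refine iSup_mono fun w => ?_
  rw [T.op_left_comm]
  refine T.op_left _ ?_
  rw [T.comm]
  refine (T.imp_op_le _ _ _).trans (T.imp_mono _ ?_)
  rw [T.comm]
  exact globalEq_op_rel_le e' e w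

lemma globalEq_self (e : point.{u} T ⟶ E) : globalEq e e = 1 :=
  le_antisymm unitInterval.le_one' (Hom.total e star star)

/-- Two global elements that are equal to degree at least `s` extend to `pair T s`. -/
lemma exists_pairIncl_comp {s : I} (e : Bool → (point.{u} T ⟶ E))
    (h : s ≤ globalEq (e false) (e true)) : ∃ f : pair T s ⟶ E, ∀ b, pairIncl s b ≫ f = e b := by
  have hle (a b : ULift Bool) : (pair.{u} T s).eq a b ≤ globalEq (e a.down) (e b.down) := by
    change (if a = b then 1 else s) ≤ _
    split_ifs with hab
    · rw [hab, globalEq_self]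
    · obtain ⟨_ | _⟩ := a <;> obtain ⟨_ | _⟩ := b
      · exact absurd rfl hab
      · exact h
      · rw [globalEq_comm]
        exact h
      · exact absurd rfl hab
  let f : pair T s ⟶ E :=
    { rel a w := Hom.rel (e a.down) star w
      le_extent a w := by
        rw [IsGlobal.eq_self a]
        exact Hom.le_extent (e a.down) star w
      compat a b w w' := by
        rw [IsGlobal.eq_self a, T.one_imp, T.comm]
        refine (T.op_left _ (Hom.compat_right (e a.down) _ w w')).trans ?_
        rw [(pair T s).symm]
        exact (T.op_right _ (hle a b)).trans (globalEq_op_rel_le _ _ _)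
      functional a w w' := by
        rw [IsGlobal.eq_self a]
        exact Hom.functional (e a.down) star w w'
      total := hle }
  exact ⟨f, fun b => Hom.ext (funext fun _ => funext fun w => ofMap_comp_rel _ _ f _ w)⟩

end distance

/-- The unit interval with the biresiduum as equality. -/
noncomputable def truthValues (T : ContinuousTNorm) : ValuedSet.{u} T :=
  ofSimilarity (ULift I) (fun a b => T.imp a.down b.down ⊓ T.imp b.down a.down)
    (fun a => by rw [T.imp_self, inf_idem]) (fun a b => inf_comm _ _)
    (fun a b c => le_inf
      ((T.mono _ _ _ _ inf_le_left inf_le_left).trans (T.imp_op_imp_le _ _ _))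
      ((T.mono _ _ _ _ inf_le_right inf_le_right).trans
        ((T.comm _ _).trans_le (T.imp_op_imp_le _ _ _))))

instance : IsGlobal (truthValues.{u} T) := inferInstanceAs (IsGlobal (ofSimilarity _ _ _ _ _))

/-- The elements of `truthValues T`. -/
def truthValue (r : I) : (truthValues.{u} T).carrier := ⟨r⟩

/-- An extensional map into the truth values, as a morphism. -/
noncomputable def toTruthValues {X : ValuedSet.{u} T} [IsGlobal X] (m : X.carrier → I)
    (hm : ∀ x y, T.op (m x) (X.eq x y) ≤ m y) : X ⟶ truthValues T :=
  ofMap (fun x => truthValue (m x))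
    (fun x y => le_inf ((T.op_le_iff _ _ _).1 (hm x y))
      ((T.op_le_iff _ _ _).1 (X.symm x y ▸ hm y x)))

/-! ### Cartesian closedness forces `p * p ≤ p * p * p` -/

section closed

open MonoidalCategory CartesianMonoidalCategory MonoidalClosed

variable [CartesianMonoidalCategory (ValuedSet.{u} T)]

/-- The comparison between the two products. -/
noncomputable def globalProdIso (X Y : ValuedSet.{u} T) [IsGlobal X] [IsGlobal Y] :
    globalProd X Y ≅ X ⊗ Y where
  hom := lift (globalFst X Y) (globalSnd X Y)
  inv := globalLift (fst X Y) (snd X Y)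
  hom_inv_id := globalProd_hom_ext
    (by rw [Category.assoc, globalLift_fst, lift_fst, Category.id_comp])
    (by rw [Category.assoc, globalLift_snd, lift_snd, Category.id_comp])
  inv_hom_id := CartesianMonoidalCategory.hom_ext _ _
    (by rw [Category.assoc, lift_fst, globalLift_fst, Category.id_comp])
    (by rw [Category.assoc, lift_snd, globalLift_snd, Category.id_comp])

/-- The map `Y × {b} → Y × pair T s`. -/
def prodPairIncl (Y : ValuedSet.{u} T) [IsGlobal Y] (s : I) (b : Bool) :
    globalProd Y (point T) ⟶ globalProd Y (pair T s) :=
  ofMap (fun a => (a.1, pairElt s b))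
    (fun _ _ => le_inf inf_le_left
      (unitInterval.le_one'.trans (IsGlobal.eq_self (pairElt s b)).ge))

lemma prodPairIncl_comp_hom (Y : ValuedSet.{u} T) [IsGlobal Y] (s : I) (b : Bool) :
    prodPairIncl Y s b ≫ (globalProdIso Y (pair T s)).hom =
      (globalProdIso Y (point T)).hom ≫ Y ◁ pairIncl s b := by
  refine CartesianMonoidalCategory.hom_ext _ _ ?_ ?_
  · simp only [globalProdIso, Category.assoc, lift_fst, whiskerLeft_fst]
    exact Hom.ext (funext fun _ => funext fun w => ofMap_comp_rel _ _ (globalFst _ _) _ w)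
  · simp only [globalProdIso, Category.assoc, lift_snd, whiskerLeft_snd, lift_snd_assoc]
    refine Hom.ext (funext fun x => funext fun w => ?_)
    exact (ofMap_comp_rel _ _ (globalSnd _ _) _ w).trans
      (ofMap_comp_rel _ _ (pairIncl _ _) _ w).symm

variable [MonoidalClosed (ValuedSet.{u} T)]

/-- In a cartesian closed category of valued sets, two families indexed by `Y` that are joined by
paths of degrees `s` and `t` through a third one are joined by a path of degree `s * t`. -/
lemma exists_glue (Y W : ValuedSet.{u} T) [IsGlobal Y] {s t : I}
    (f : globalProd Y (pair T s) ⟶ W) (g : globalProd Y (pair T t) ⟶ W)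
    (h : prodPairIncl Y s true ≫ f = prodPairIncl Y t false ≫ g) :
    ∃ k : globalProd Y (pair T (T.op s t)) ⟶ W,
      prodPairIncl Y _ false ≫ k = prodPairIncl Y s false ≫ f ∧
        prodPairIncl Y _ true ≫ k = prodPairIncl Y t true ≫ g := by
  -- Families over `Y` become global elements of the exponential, where degrees compose by
  -- `globalEq_trans`.
  let c (a : globalProd Y (point T) ⟶ W) : point T ⟶ (ihom Y).obj W :=
    curry ((globalProdIso Y (point T)).inv ≫ a)
  have hc (r : I) (b : Bool) (a : globalProd Y (pair T r) ⟶ W) :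
      pairIncl r b ≫ curry ((globalProdIso Y (pair T r)).inv ≫ a) = c (prodPairIncl Y r b ≫ a) := by
    rw [← curry_natural_left]
    congr 1
    rw [Iso.eq_inv_comp, ← Category.assoc, ← prodPairIncl_comp_hom, Category.assoc,
      Iso.hom_inv_id_assoc]
  have hs := le_globalEq (curry ((globalProdIso Y (pair T s)).inv ≫ f))
  have ht := le_globalEq (curry ((globalProdIso Y (pair T t)).inv ≫ g))
  rw [hc, hc] at hs ht
  rw [← h] at ht
  obtain ⟨k, hk⟩ := exists_pairIncl_comp
    (fun b => c (bif b then prodPairIncl Y t true ≫ g else prodPairIncl Y s false ≫ f))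
    ((T.mono _ _ _ _ hs ht).trans (globalEq_trans _ _ _))
  have hk' (b : Bool) : prodPairIncl Y _ b ≫ (globalProdIso Y _).hom ≫ uncurry k =
      bif b then prodPairIncl Y t true ≫ g else prodPairIncl Y s false ≫ f := by
    rw [← Category.assoc, prodPairIncl_comp_hom, Category.assoc, ← uncurry_natural_left, hk,
      uncurry_curry, Iso.hom_inv_id_assoc]
  exact ⟨_, hk' false, hk' true⟩

lemma square_le_cube (p : I) : T.op p p ≤ T.op p (T.op p p) := by
  set c := T.op p p with hc
  have hcp : c ≤ p := T.op_le_left p p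
  have hdc : T.op p c ≤ c := T.op_le_right p c
  have hc_op (x : I) : T.op c x ≤ c := T.op_le_left c x
  have hc_op' (x : I) : T.op c x ≤ p := (hc_op x).trans hcp
  have hd_op (x : I) : T.op (T.op p c) x ≤ c := (T.op_le_left _ x).trans hdc
  have hd_op' (x : I) : T.op (T.op p c) x ≤ p := (hd_op x).trans hcp
  have hcc : T.op c c ≤ T.op p c := T.op_right c hcp
  have hmin (x : I) : min 1 x = x := min_eq_right unitInterval.le_one'
  have hmin' (x : I) : min x 1 = x := min_eq_left unitInterval.le_one'
  have hle (x : I) : x ≤ 1 := unitInterval.le_one'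
  -- On the two points of `Y`, `f` moves the values `(1, c)` to `(p, c)`, and `g` moves `(p, c)` to
  -- `(c, p * c)`. Each step is extensional at degree `p`, and the diagonals at degree `min c p =
  -- c`.
  let f : globalProd (pair T c) (pair T p) ⟶ truthValues.{u} T := toTruthValues
    (fun a => bif a.2.down then bif a.1.down then c else p else bif a.1.down then c else 1)
    (by
      rintro ⟨⟨_ | _⟩, ⟨_ | _⟩⟩ ⟨⟨_ | _⟩, ⟨_ | _⟩⟩ <;>
        simp [globalProd, pair, ofSimilarity, T.one_op, T.op_one, hcp, hdc, hc_op, hc_op', hle])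
  let g : globalProd (pair T c) (pair T p) ⟶ truthValues.{u} T := toTruthValues
    (fun a => bif a.2.down then bif a.1.down then T.op p c else c else bif a.1.down then c else p)
    (by
      rintro ⟨⟨_ | _⟩, ⟨_ | _⟩⟩ ⟨⟨_ | _⟩, ⟨_ | _⟩⟩ <;>
        simp [globalProd, pair, ofSimilarity, T.op_one, hcp, hdc, hc_op, hc_op', hd_op, hd_op', hcc,
          T.op_le_left p c, hmin, hmin', ← hc, T.comm c p])
  obtain ⟨k, hk₀, hk₁⟩ := exists_glue (pair T c) (truthValues T) f g
    (Hom.ext (funext fun a => funext fun w => (ofMap_comp_rel _ _ f a w).trans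
      (.trans (by rfl) (ofMap_comp_rel _ _ g a w).symm)))
  have h₀ : Hom.rel k (pairElt c false, pairElt c false) = (truthValues T).eq (truthValue 1) := by
    funext w
    have h := congrFun (congrFun (congrArg Hom.rel hk₀) (pairElt c false, star)) w
    exact ((ofMap_comp_rel _ _ k _ w).symm.trans h).trans (ofMap_comp_rel _ _ f _ w)
  have h₁ : Hom.rel k (pairElt c true, pairElt c true) =
      (truthValues T).eq (truthValue (T.op p c)) := by
    funext w
    have h := congrFun (congrFun (congrArg Hom.rel hk₁) (pairElt c true, star)) w
    exact ((ofMap_comp_rel _ _ k _ w).symm.trans h).trans (ofMap_comp_rel _ _ g _ w)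
  have h := (Hom.eq_le_of_rel_eq k h₀ h₁).trans inf_le_left
  -- Both coordinates change at degree `c`, and the product takes their meet, which is `c` rather
  -- than `c * c`.
  change (pair T c).eq (pairElt c false) (pairElt c true) ⊓
    (pair T c).eq (pairElt c false) (pairElt c true) ≤ T.imp 1 (T.op p c) at h
  rwa [T.one_imp, pair_eq_false_true, inf_idem] at h

end closed

end ValuedSet

/-! ### The minimum t-norm: axioms without residua, and products -/

namespace ContinuousTNorm

lemma minimum_op (p q : I) : minimum.op p q = p ⊓ q := rfl

/-- Residua by an extent `q` occur in the axioms next to a factor below `q`, so this eliminates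
them. -/
lemma inf_minimum_imp {b q : I} (h : b ≤ q) (a : I) : b ⊓ minimum.imp q a = b ⊓ a :=
  le_antisymm (le_inf inf_le_left ((inf_le_inf_right _ h).trans (minimum.op_imp_le q a)))
    (inf_le_inf_left _ ((minimum.op_le_iff _ _ _).1 (minimum.op_le_right q a)))

end ContinuousTNorm

namespace ValuedSet

open ContinuousTNorm

section minimum

lemma inf_eq_le (X : ValuedSet.{u} minimum) (x y z : X.carrier) :
    X.eq x y ⊓ X.eq y z ≤ X.eq x z := by
  have h := X.trans x y z
  rwa [minimum_op, inf_minimum_imp (X.eq_le_left y z), inf_comm] at h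

/-- A valued set for the minimum t-norm. -/
def mkOfMinimum (S : Type u) (eq : S → S → I) (symm : ∀ x y, eq x y = eq y x)
    (trans : ∀ x y z, eq x y ⊓ eq y z ≤ eq x z) : ValuedSet.{u} minimum where
  carrier := S
  eq := eq
  le_extent x y := le_inf
    ((le_inf le_rfl (symm x y).le).trans (trans x y x))
    ((le_inf (symm x y).le le_rfl).trans (trans y x y))
  symm := symm
  trans x y z := by
    have hyz : eq y z ≤ eq y y := (le_inf le_rfl (symm y z).le).trans (trans y z y)
    rw [minimum_op, inf_minimum_imp hyz, inf_comm]
    exact trans x y z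

namespace Hom

variable {X Y Z : ValuedSet.{u} minimum}

lemma rel_inf_eq_left_le (f : Hom X Y) (x x' : X.carrier) (y : Y.carrier) :
    f.rel x y ⊓ X.eq x x' ≤ f.rel x' y := by
  have h := f.compat_left x x' y
  rwa [minimum_op, inf_minimum_imp (f.le_left x y), X.symm x' x] at h

lemma rel_inf_eq_right_le (f : Hom X Y) (x : X.carrier) (y y' : Y.carrier) :
    f.rel x y ⊓ Y.eq y y' ≤ f.rel x y' := by
  have h := f.compat_right x y y'
  rwa [minimum_op, inf_comm, inf_minimum_imp (f.le_right x y)] at h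

lemma rel_inf_rel_le (f : Hom X Y) (x : X.carrier) (y y' : Y.carrier) :
    f.rel x y ⊓ f.rel x y' ≤ Y.eq y y' := by
  have h := f.functional x y y'
  rwa [minimum_op, inf_minimum_imp (f.le_left x y'), inf_comm] at h

lemma eq_self_le_iSup (f : Hom X Y) (x : X.carrier) : X.eq x x ≤ ⨆ y, f.rel x y :=
  (f.total x x).trans (iSup_mono fun _ => inf_le_left)

/-- A morphism of valued sets for the minimum t-norm. -/
def mkOfMinimum (rel : X.carrier → Y.carrier → I)
    (le_left : ∀ x y, rel x y ≤ X.eq x x) (le_right : ∀ x y, rel x y ≤ Y.eq y y)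
    (compat_left : ∀ x x' y, rel x y ⊓ X.eq x x' ≤ rel x' y)
    (compat_right : ∀ x y y', rel x y ⊓ Y.eq y y' ≤ rel x y')
    (functional : ∀ x y y', rel x y ⊓ rel x y' ≤ Y.eq y y')
    (total : ∀ x, X.eq x x ≤ ⨆ y, rel x y) : Hom X Y :=
  mkOfTotal rel (fun x y => le_inf (le_left x y) (le_right x y))
    (fun x x' y y' => by
      rw [minimum_op, minimum_op, inf_comm (minimum.imp _ _), inf_minimum_imp (le_right x y),
        inf_minimum_imp (inf_le_left.trans (le_left x y)), X.symm]
      exact (inf_le_inf_right _ (compat_right x y y')).trans (compat_left x x' y'))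
    (fun x y y' => by
      rw [minimum_op, inf_minimum_imp (le_left x y'), inf_comm]
      exact functional x y y')
    (fun x => (total x).trans (iSup_mono fun y => by
      rw [minimum_op, inf_minimum_imp (le_right x y), inf_idem]))

lemma comp_rel (f : X ⟶ Y) (g : Y ⟶ Z) (x : X.carrier) (z : Z.carrier) :
    rel (f ≫ g) x z = ⨆ y, rel f x y ⊓ rel g y z := by
  change compRel f g x z = _
  unfold compRel
  congr 1
  funext y
  rw [minimum_op, inf_minimum_imp (g.le_left y z), inf_comm]

end Hom

/-- The product for the minimum t-norm. -/
def prod (X Y : ValuedSet.{u} minimum) : ValuedSet.{u} minimum :=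
  mkOfMinimum (X.carrier × Y.carrier) (fun a b => X.eq a.1 b.1 ⊓ Y.eq a.2 b.2)
    (fun a b => by rw [X.symm, Y.symm])
    (fun a b c => le_inf
      ((inf_le_inf inf_le_left inf_le_left).trans (X.inf_eq_le _ _ _))
      ((inf_le_inf inf_le_right inf_le_right).trans (Y.inf_eq_le _ _ _)))

/-- The first projection. -/
def prodFst (X Y : ValuedSet.{u} minimum) : prod X Y ⟶ X :=
  -- The factor `Y.eq a.2 a.2` cuts the relation down to the extent of the pair, which may be
  -- smaller than that of `a.1`.
  Hom.mkOfMinimum (fun a x => X.eq a.1 x ⊓ Y.eq a.2 a.2)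
    (fun _ _ => inf_le_inf_right _ (X.eq_le_left _ _))
    (fun _ _ => inf_le_left.trans (X.eq_le_right _ _))
    (fun a b x => le_inf
      ((le_inf ((inf_le_right.trans inf_le_left).trans (X.symm _ _).le)
        (inf_le_left.trans inf_le_left)).trans (X.inf_eq_le b.1 a.1 x))
      ((inf_le_right.trans inf_le_right).trans (Y.eq_le_right _ _)))
    (fun _ _ _ => le_inf
      ((inf_le_inf_right _ inf_le_left).trans (X.inf_eq_le _ _ _))
      (inf_le_left.trans inf_le_right))
    (fun _ _ _ => (inf_le_inf (inf_le_left.trans (X.symm _ _).le) inf_le_left).trans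
      (X.inf_eq_le _ _ _))
    (fun a => le_iSup (fun x => X.eq a.1 x ⊓ Y.eq a.2 a.2) a.1)

/-- The second projection. -/
def prodSnd (X Y : ValuedSet.{u} minimum) : prod X Y ⟶ Y :=
  Hom.mkOfMinimum (fun a y => X.eq a.1 a.1 ⊓ Y.eq a.2 y)
    (fun _ _ => inf_le_inf_left _ (Y.eq_le_left _ _))
    (fun _ _ => inf_le_right.trans (Y.eq_le_right _ _))
    (fun a b y => le_inf
      ((inf_le_right.trans inf_le_left).trans (X.eq_le_right _ _))
      ((le_inf ((inf_le_right.trans inf_le_right).trans (Y.symm _ _).le)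
        (inf_le_left.trans inf_le_right)).trans (Y.inf_eq_le b.2 a.2 y)))
    (fun _ _ _ => le_inf
      (inf_le_left.trans inf_le_left)
      ((inf_le_inf_right _ inf_le_right).trans (Y.inf_eq_le _ _ _)))
    (fun _ _ _ => (inf_le_inf (inf_le_right.trans (Y.symm _ _).le) inf_le_right).trans
      (Y.inf_eq_le _ _ _))
    (fun a => le_iSup (fun y => X.eq a.1 a.1 ⊓ Y.eq a.2 y) a.2)

section prod

variable {X Y Z : ValuedSet.{u} minimum}

/-- The pairing of two morphisms. -/
def prodLift (f : Z ⟶ X) (g : Z ⟶ Y) : Z ⟶ prod X Y :=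
  Hom.mkOfMinimum (fun z a => Hom.rel f z a.1 ⊓ Hom.rel g z a.2)
    (fun z a => inf_le_left.trans (Hom.le_left f _ _))
    (fun z a => inf_le_inf (Hom.le_right f _ _) (Hom.le_right g _ _))
    (fun z z' a => le_inf
      ((inf_le_inf_right _ inf_le_left).trans (Hom.rel_inf_eq_left_le f _ _ _))
      ((inf_le_inf_right _ inf_le_right).trans (Hom.rel_inf_eq_left_le g _ _ _)))
    (fun z a b => le_inf
      ((inf_le_inf inf_le_left inf_le_left).trans (Hom.rel_inf_eq_right_le f _ _ _))
      ((inf_le_inf inf_le_right inf_le_right).trans (Hom.rel_inf_eq_right_le g _ _ _)))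
    (fun z a b => le_inf
      ((inf_le_inf inf_le_left inf_le_left).trans (Hom.rel_inf_rel_le f _ _ _))
      ((inf_le_inf inf_le_right inf_le_right).trans (Hom.rel_inf_rel_le g _ _ _)))
    (fun z => by
      refine (le_inf (Hom.eq_self_le_iSup f z) (Hom.eq_self_le_iSup g z)).trans ?_
      rw [iSup_inf_eq]
      refine iSup_le fun x => ?_
      rw [inf_iSup_eq]
      exact iSup_le fun y =>
        le_iSup (fun a : X.carrier × Y.carrier => Hom.rel f z a.1 ⊓ Hom.rel g z a.2) (x, y))

lemma prodLift_fst (f : Z ⟶ X) (g : Z ⟶ Y) : prodLift f g ≫ prodFst X Y = f := by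
  refine Hom.eq_of_rel_le fun z x => ?_
  rw [Hom.comp_rel]
  exact iSup_le fun a => (inf_le_inf inf_le_left inf_le_left).trans
    (Hom.rel_inf_eq_right_le f z a.1 x)

lemma prodLift_snd (f : Z ⟶ X) (g : Z ⟶ Y) : prodLift f g ≫ prodSnd X Y = g := by
  refine Hom.eq_of_rel_le fun z y => ?_
  rw [Hom.comp_rel]
  exact iSup_le fun a => (inf_le_inf inf_le_right inf_le_right).trans
    (Hom.rel_inf_eq_right_le g z a.2 y)

lemma eq_prodLift (h : Z ⟶ prod X Y) : h = prodLift (h ≫ prodFst X Y) (h ≫ prodSnd X Y) := by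
  refine Hom.eq_of_rel_le fun z a => ?_
  change _ ≤ Hom.rel (h ≫ prodFst X Y) z a.1 ⊓ Hom.rel (h ≫ prodSnd X Y) z a.2
  rw [Hom.comp_rel, Hom.comp_rel]
  exact le_inf (le_iSup_of_le a (le_inf le_rfl (Hom.le_right h z a)))
    (le_iSup_of_le a (le_inf le_rfl (Hom.le_right h z a)))

end prod

/-- The products of valued sets for the minimum t-norm, as limit cones. -/
noncomputable def prodLimitCone (X Y : ValuedSet.{u} minimum) :
    Limits.LimitCone (Limits.pair X Y) where
  cone := Limits.BinaryFan.mk (prodFst X Y) (prodSnd X Y)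
  isLimit := Limits.BinaryFan.IsLimit.mk _ prodLift prodLift_fst prodLift_snd
    (fun f g m hf hg => by
      subst hf hg
      exact eq_prodLift m)

/-- For the minimum t-norm the singleton of extent `1` is terminal. -/
noncomputable def pointIsTerminal : Limits.IsTerminal (point.{u} minimum) :=
  Limits.IsTerminal.ofUniqueHom
    (fun X => Hom.mkOfMinimum (fun x _ => X.eq x x) (fun _ _ => le_rfl)
      (fun _ _ => unitInterval.le_one') (fun _ x' _ => inf_le_right.trans (X.eq_le_right _ x'))
      (fun _ _ _ => inf_le_left) (fun _ _ _ => unitInterval.le_one')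
      (fun x => le_iSup (fun _ : (point.{u} minimum).carrier => X.eq x x) star))
    (fun _ f => Hom.eq_of_rel_le fun x y => Hom.le_left f x y)

/-- The cartesian structure for the minimum t-norm. -/
noncomputable abbrev cartesianMonoidal : CartesianMonoidalCategory (ValuedSet.{u} minimum) :=
  .ofChosenFiniteProducts ⟨_, pointIsTerminal⟩ prodLimitCone

/-- A morphism from the restriction of `Y` to `extent` into `Z`. -/
structure PartialHom (Y Z : ValuedSet.{u} minimum) where
  extent : I
  rel : Y.carrier → Z.carrier → I
  le_extent : ∀ y z, rel y z ≤ extent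
  le_left : ∀ y z, rel y z ≤ Y.eq y y
  le_right : ∀ y z, rel y z ≤ Z.eq z z
  compat_left : ∀ y y' z, rel y z ⊓ Y.eq y y' ≤ rel y' z
  compat_right : ∀ y z z', rel y z ⊓ Z.eq z z' ≤ rel y z'
  functional : ∀ y z z', rel y z ⊓ rel y z' ≤ Z.eq z z'
  total : ∀ y, Y.eq y y ⊓ extent ≤ ⨆ z, rel y z

/-! ### Equality of partial morphisms -/

namespace PartialHom

variable {Y Z : ValuedSet.{u} minimum}

/-- `F` and `G` are defined on `r` and agree there. -/
def AgreeOn (F G : PartialHom Y Z) (r : I) : Prop :=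
  r ≤ F.extent ∧ r ≤ G.extent ∧ ∀ y z, F.rel y z ⊓ r = G.rel y z ⊓ r

/-- The largest extent on which `F` and `G` agree. -/
noncomputable def eq (F G : PartialHom Y Z) : I := sSup {r | AgreeOn F G r}

/-- The supremum is attained because meets distribute over suprema. -/
lemma agreeOn_eq (F G : PartialHom Y Z) : AgreeOn F G (eq F G) := by
  refine ⟨sSup_le fun r h => h.1, sSup_le fun r h => h.2.1, fun y z => ?_⟩
  simp only [eq, inf_sSup_eq]
  exact iSup_congr fun r => iSup_congr fun h => h.2.2 y z

lemma le_eq {F G : PartialHom Y Z} {r : I} (h : AgreeOn F G r) : r ≤ eq F G := le_sSup h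

lemma rel_inf_eq_le (F G : PartialHom Y Z) (y : Y.carrier) (z : Z.carrier) :
    F.rel y z ⊓ eq F G ≤ G.rel y z := ((agreeOn_eq F G).2.2 y z).trans_le inf_le_left

lemma eq_self (F : PartialHom Y Z) : eq F F = F.extent :=
  le_antisymm (agreeOn_eq F F).1 (le_eq ⟨le_rfl, le_rfl, fun _ _ => rfl⟩)

lemma eq_comm (F G : PartialHom Y Z) : eq F G = eq G F := by
  have key (F G : PartialHom Y Z) : eq F G ≤ eq G F :=
    have h := agreeOn_eq F G
    le_eq ⟨h.2.1, h.1, fun y z => (h.2.2 y z).symm⟩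
  exact le_antisymm (key F G) (key G F)

lemma eq_trans (F G H : PartialHom Y Z) : eq F G ⊓ eq G H ≤ eq F H := by
  have h₁ := agreeOn_eq F G
  have h₂ := agreeOn_eq G H
  refine le_eq ⟨inf_le_left.trans h₁.1, inf_le_right.trans h₂.2.1, fun y z => ?_⟩
  rw [← inf_assoc, h₁.2.2, inf_right_comm, h₂.2.2, inf_assoc, inf_comm (eq G H)]

end PartialHom

/-- The exponential for the minimum t-norm. -/
noncomputable def exp (Y Z : ValuedSet.{u} minimum) : ValuedSet.{u} minimum :=
  mkOfMinimum (PartialHom Y Z) PartialHom.eq PartialHom.eq_comm PartialHom.eq_trans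

/-! ### Currying for the minimum t-norm -/

section exp

variable {X Y Z : ValuedSet.{u} minimum}

/-- The partial morphism that a morphism `Y × X → Z` defines at an element of `X`. -/
def slice (h : prod Y X ⟶ Z) (x : X.carrier) : PartialHom Y Z where
  extent := X.eq x x
  rel y z := Hom.rel h (y, x) z
  le_extent y z := (Hom.le_left h (y, x) z).trans inf_le_right
  le_left y z := (Hom.le_left h (y, x) z).trans inf_le_left
  le_right y z := Hom.le_right h (y, x) z
  compat_left y y' z :=
    (le_inf inf_le_left
      (le_inf inf_le_right (inf_le_left.trans ((Hom.le_left h (y, x) z).trans inf_le_right)))).trans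
      (Hom.rel_inf_eq_left_le h (y, x) (y', x) z)
  compat_right y := Hom.rel_inf_eq_right_le h (y, x)
  functional y := Hom.rel_inf_rel_le h (y, x)
  total y := Hom.eq_self_le_iSup h (y, x)

lemma eq_le_eq_slice (h : prod Y X ⟶ Z) (x x' : X.carrier) :
    X.eq x x' ≤ PartialHom.eq (slice h x) (slice h x') := by
  have key (x x' : X.carrier) (y : Y.carrier) (z : Z.carrier) :
      Hom.rel h (y, x) z ⊓ X.eq x x' ≤ Hom.rel h (y, x') z :=
    (le_inf inf_le_left
      (le_inf (inf_le_left.trans ((Hom.le_left h (y, x) z).trans inf_le_left)) inf_le_right)).trans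
      (Hom.rel_inf_eq_left_le h (y, x) (y, x') z)
  refine PartialHom.le_eq ⟨X.eq_le_left x x', X.eq_le_right x x', fun y z => ?_⟩
  refine le_antisymm (le_inf (key x x' y z) inf_le_right) (le_inf ?_ inf_le_right)
  rw [X.symm]
  exact key x' x y z

/-- Currying. -/
noncomputable def curryMin (h : prod Y X ⟶ Z) : X ⟶ exp Y Z :=
  Hom.ofFun (slice h) (fun x => PartialHom.eq_self (slice h x)) (eq_le_eq_slice h)

/-- By functionality of `k`, two candidate values `F` and `G` agree on the meet of their degrees;
hence uncurrying is single-valued. -/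
lemma rel_inf_rel_inf_rel_le (k : X ⟶ exp Y Z) (x : X.carrier) (F G : PartialHom Y Z)
    (y : Y.carrier) (z : Z.carrier) :
    (Hom.rel k x F ⊓ F.rel y z) ⊓ Hom.rel k x G ≤ G.rel y z :=
  (le_inf (inf_le_left.trans inf_le_right)
    ((inf_le_inf_right _ inf_le_left).trans (Hom.rel_inf_rel_le k x F G))).trans
    (PartialHom.rel_inf_eq_le F G y z)

/-- Uncurrying. -/
noncomputable def uncurryMin (k : X ⟶ exp Y Z) : prod Y X ⟶ Z :=
  Hom.mkOfMinimum (fun a z => ⨆ F : PartialHom Y Z, Hom.rel k a.2 F ⊓ F.rel a.1 z)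
    (fun a z => iSup_le fun F => le_inf (inf_le_right.trans (F.le_left _ _))
      (inf_le_left.trans (Hom.le_left k a.2 F)))
    (fun a z => iSup_le fun F => inf_le_right.trans (F.le_right _ _))
    (fun a b z => by
      rw [iSup_inf_eq]
      exact iSup_mono fun F => le_inf
        ((inf_le_inf inf_le_left inf_le_right).trans (Hom.rel_inf_eq_left_le k a.2 b.2 F))
        ((inf_le_inf inf_le_right inf_le_left).trans (F.compat_left a.1 b.1 z)))
    (fun a z z' => by
      rw [iSup_inf_eq]
      exact iSup_mono fun F => le_inf (inf_le_left.trans inf_le_left)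
        ((inf_le_inf_right _ inf_le_right).trans (F.compat_right a.1 z z')))
    (fun a z z' => by
      rw [iSup_inf_eq]
      refine iSup_le fun F => ?_
      rw [inf_iSup_eq]
      exact iSup_le fun G => (le_inf
        ((inf_le_inf_left _ inf_le_left).trans (rel_inf_rel_inf_rel_le k a.2 F G a.1 z))
        (inf_le_right.trans inf_le_right)).trans (G.functional a.1 z z'))
    (fun a => by
      refine (le_inf inf_le_left (inf_le_right.trans (Hom.eq_self_le_iSup k a.2))).trans ?_
      rw [inf_iSup_eq, iSup_comm]
      refine iSup_mono fun F => ?_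
      rw [← inf_iSup_eq]
      -- `F` is total only up to its extent, which bounds its weight.
      have hF : Hom.rel k a.2 F ≤ F.extent :=
        (Hom.le_right k a.2 F).trans (PartialHom.eq_self F).le
      exact le_inf inf_le_right ((inf_le_inf_left _ hF).trans (F.total a.1)))

lemma uncurryMin_curryMin (h : prod Y X ⟶ Z) : uncurryMin (curryMin h) = h := by
  refine Hom.eq_of_rel_le fun a z => iSup_le fun F => ?_
  have hF := PartialHom.rel_inf_eq_le F (slice h a.2) a.1 z
  rw [PartialHom.eq_comm, inf_comm] at hF
  exact hF

/-- It suffices that `k` lies below the left side: `Hom.rel k x F` is itself an extent on which `F`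
and the slice at `x` agree. -/
lemma curryMin_uncurryMin (k : X ⟶ exp Y Z) : curryMin (uncurryMin k) = k := by
  refine (Hom.eq_of_rel_le fun x F => ?_).symm
  refine PartialHom.le_eq (F := slice (uncurryMin k) x) ⟨Hom.le_left k x F,
    (Hom.le_right k x F).trans (PartialHom.eq_self F).le, fun y z => ?_⟩
  refine le_antisymm (le_inf ?_ inf_le_right) (le_inf ?_ inf_le_right)
  · change (⨆ G : PartialHom Y Z, Hom.rel k x G ⊓ G.rel y z) ⊓ _ ≤ _
    rw [iSup_inf_eq]
    exact iSup_le fun G => rel_inf_rel_inf_rel_le k x G F y z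
  · rw [inf_comm]
    exact le_iSup (fun G : PartialHom Y Z => Hom.rel k x G ⊓ G.rel y z) F

lemma uncurryMin_comp {X' : ValuedSet.{u} minimum} (f : X' ⟶ X) (k : X ⟶ exp Y Z) :
    uncurryMin (f ≫ k) = prodLift (prodFst Y X') (prodSnd Y X' ≫ f) ≫ uncurryMin k := by
  refine Hom.eq_of_rel_le fun ⟨y, x'⟩ z => ?_
  refine iSup_le fun F => ?_
  refine (inf_le_inf_right _ (Hom.comp_rel f k x' F).le).trans
    (le_trans ?_ (Hom.comp_rel _ _ _ _).ge)
  rw [iSup_inf_eq]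
  refine iSup_le fun x => le_iSup_of_le (y, x) ?_
  have hE : (Hom.rel f x' x ⊓ Hom.rel k x F) ⊓ F.rel y z ≤ Y.eq y y ⊓ X'.eq x' x' :=
    le_inf (inf_le_right.trans (F.le_left y z))
      ((inf_le_left.trans inf_le_left).trans (Hom.le_left f x' x))
  refine le_inf (le_inf hE ?_) ?_
  · exact (le_iSup_of_le x' (le_inf hE (inf_le_left.trans inf_le_left))).trans
      (Hom.comp_rel (prodSnd Y X') f (y, x') x).ge
  · exact le_iSup_of_le F (inf_le_inf_right _ inf_le_right)

lemma curryMin_comp {X' : ValuedSet.{u} minimum} (f : X' ⟶ X) (g : prod Y X ⟶ Z) :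
    curryMin (prodLift (prodFst Y X') (prodSnd Y X' ≫ f) ≫ g) = f ≫ curryMin g := by
  rw [← curryMin_uncurryMin (f ≫ curryMin g), uncurryMin_comp, uncurryMin_curryMin]

/-- The currying equivalence. -/
noncomputable def curryMinEquiv (X Y Z : ValuedSet.{u} minimum) :
    (prod Y X ⟶ Z) ≃ (X ⟶ exp Y Z) where
  toFun := curryMin
  invFun := uncurryMin
  left_inv := uncurryMin_curryMin
  right_inv := curryMin_uncurryMin

end exp

theorem isCartesianClosed_minimum : IsCartesianClosed (ValuedSet.{u} minimum) := by
  let _ := cartesianMonoidal.{u}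
  refine ⟨inferInstance, ⟨⟨fun Y => ⟨_, Adjunction.adjunctionOfEquivRight
    (F := MonoidalCategory.tensorLeft Y) (G_obj := exp Y) (fun X Z => curryMinEquiv X Y Z) ?_⟩⟩⟩⟩
  intro X' X Z f g
  have hw : MonoidalCategory.whiskerLeft Y f = prodLift (prodFst Y X') (prodSnd Y X' ≫ f) :=
    CartesianMonoidalCategory.hom_ext _ _
      ((CartesianMonoidalCategory.whiskerLeft_fst Y f).trans (prodLift_fst _ _).symm)
      ((CartesianMonoidalCategory.whiskerLeft_snd Y f).trans (prodLift_snd _ _).symm)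
  exact (congrArg (fun t : prod Y X' ⟶ prod Y X => curryMin (t ≫ g)) hw).trans
    (curryMin_comp f g)

end minimum

end ValuedSet

theorem mainTheorem1 (T : ContinuousTNorm) :
    IsCartesianClosed (ValuedSet.{u} T) ↔ T = ContinuousTNorm.minimum := by
  constructor
  · rintro ⟨_, ⟨_⟩⟩
    by_contra h
    obtain ⟨p, hp⟩ := T.exists_cube_lt_square h
    exact hp.not_ge (ValuedSet.square_le_cube p)
  · rintro rfl
    exact ValuedSet.isCartesianClosed_minimum
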